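/- Proposition 4.3. Conventions: permutations are multiplied from left to right. For permutations $r,s$ of a finite set such that $rs$ is an involution, let $G=\langle r,s\rangle$ and let $\mathcal M(G:r,s)$ be the map on an oriented surface whose arcs are the elements of $G$, where the arc following $g$ in the rotation around its initial vertex is $gs$ and the reverse of the arc $g$ is $g\cdot rs$; consequently the arc following $g$ along its face is $gr$. A map has type $\{m,n\}$ if all its faces have length $m$ and all its vertices have valency $n$. It is orientably-regular if its orientation-preserving automorphisms are transitive on arcs, and chiral if it is orientably-regular but not isomorphic to its mirror image (for $\mathcal M(G:r,s)$ this means that no automorphism of $G$ inverts both $r$ and $s$). Let $a\ge 0$, $i\in\{-1,1\}$ and $n=4a+7+i\ge 8$. Let the set of points consist of $1,\dots,2a$, $1',\dots,(2a)'$ and the letters $\alpha,\alpha',\beta,\beta',\gamma,\gamma',\delta,\delta',\epsilon,\zeta$, together with one more letter $\eta$ when $i=1$; let $k$ be the number of points, so $k=n+4$ if $i=-1$ and $k=n+3$ if $i=1$. Put $$t=(\alpha,\alpha')(\beta,\beta')(\gamma,\gamma')(\delta,\delta')\prod_{j=1}^{2a}(j,j')$$ and $s=s_i$, where $$s_{-1}=(1,2,\dots,2a,\alpha,\gamma,\epsilon,(2a)',(2a-1)',\dots,1',\delta,\zeta,\delta')(\alpha',\beta),$$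 $$s_{1}=(1,2,\dots,2a,\alpha,\beta,\gamma,\gamma',\epsilon,(2a)',(2a-1)',\dots,1',\delta,\zeta,\delta')(\alpha',\eta)$$ (for $a=0$ the numbered points are omitted). Let $r=ts^{-1}$, so that $rs=t$, and $G=\langle r,s\rangle=\langle s,t\rangle$. Then $\mathcal M(G:r,s)$ is a chiral map of type $\{8,n\}$, and $G=A_k$, the alternating group on the set of points. -/

import Mathlib

open Equiv

/-! ## Oriented maps -/

/-- A map on an oriented surface, given in the usual combinatorial way by its set `A` of arcs
(directed edges): `rot` is the one-step rotation of the arcs around their initial vertices, and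
`rev` reverses the direction of an arc.  The vertices, edges and faces are the orbits of `rot`, of
`rev` and of `x ↦ rot⁻¹ (rev x)`; connectedness of the embedded graph is transitivity of the group
generated by `rot` and `rev`. -/
structure OrientedMap (A : Type*) where
  rot : Perm A
  rev : Perm A
  rev_rev : ∀ x, rev (rev x) = x
  rev_ne : ∀ x, rev x ≠ x
  connected : ∀ x y, ∃ g ∈ Subgroup.closure {rot, rev}, g x = y
  nonempty : Nonempty A

namespace OrientedMap

variable {A : Type*}

/-- The one-step rotation of the arcs along the faces. -/
def face (M : OrientedMap A) : Perm A := M.rot⁻¹ * M.rev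

/-- Type `{m, n}`: every face has length `m` and every vertex has valency `n`. -/
def HasType (M : OrientedMap A) (m n : ℕ) : Prop :=
  (∀ x, Function.minimalPeriod M.face x = m) ∧ (∀ x, Function.minimalPeriod M.rot x = n)

/-- Orientation-preserving automorphisms of a map. -/
def IsAut (M : OrientedMap A) (f : Perm A) : Prop :=
  (∀ x, f (M.rot x) = M.rot (f x)) ∧ (∀ x, f (M.rev x) = M.rev (f x))

/-- Orientation-reversing automorphisms of a map: isomorphisms onto the mirror image, which has the
same edges and the opposite rotation at every vertex. -/
def IsReflection (M : OrientedMap A) (f : Perm A) : Prop :=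
  (∀ x, f (M.rot x) = M.rot⁻¹ (f x)) ∧ (∀ x, f (M.rev x) = M.rev (f x))

/-- The orientation-preserving automorphisms are transitive on the arcs. -/
def IsOrientablyRegular (M : OrientedMap A) : Prop :=
  ∀ x y, ∃ f, M.IsAut f ∧ f x = y

/-- A chiral map: orientably regular and not reflexible. -/
def IsChiral (M : OrientedMap A) : Prop :=
  M.IsOrientablyRegular ∧ ¬ ∃ f, M.IsReflection f

end OrientedMap

/-! ## The map of a pair of permutations

Permutations act on the right in the source, so that a product `x y` there means "first `x`, then
`y`"; it is the Mathlib product `y * x`.  In particular `t = r s` reads `t = s * r`. -/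

section ofPerms

variable {X : Type*}

/-- The group `G = ⟨r, s⟩`. -/
def genGroup (r s : Perm X) : Subgroup (Perm X) := Subgroup.closure {r, s}

/-- `r` as an element of `⟨r, s⟩`. -/
def genGroup.r (r s : Perm X) : genGroup r s :=
  ⟨r, Subgroup.subset_closure (Or.inl rfl)⟩

/-- `s` as an element of `⟨r, s⟩`. -/
def genGroup.s (r s : Perm X) : genGroup r s :=
  ⟨s, Subgroup.subset_closure (Or.inr rfl)⟩

theorem genGroup_closure (r s : Perm X) :
    Subgroup.closure {genGroup.r r s, genGroup.s r s} = ⊤ := by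
  have h := Subgroup.closure_closure_coe_preimage (k := ({r, s} : Set (Perm X)))
  refine Eq.trans (congrArg _ ?_) h
  ext x
  simp only [Set.mem_insert_iff, Set.mem_singleton_iff, Subtype.ext_iff]
  rfl

/-- The map `M(G : r, s)` with `G = ⟨r, s⟩`, for permutations `r`, `s` such that `t = r s` is an
involution.  Its arcs are the elements of `G`; in the left-to-right notation for products, the arc
following `g` around its vertex is `g s`, the reverse of `g` is `g t`, and hence the arc following
`g` around its face is `g t s⁻¹ = g r`; the elements of `G` act as automorphisms on the other
side. -/
def mapOfPerms (r s : Perm X) (h : orderOf (s * r) = 2) : OrientedMap (genGroup r s) where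
  rot := Equiv.mulLeft (genGroup.s r s)
  rev := Equiv.mulLeft (genGroup.s r s * genGroup.r r s)
  rev_rev x := by
    have h2 : (s * r) * (s * r) = 1 := by rw [← sq, ← h]; exact pow_orderOf_eq_one _
    have h3 : (genGroup.s r s * genGroup.r r s) * (genGroup.s r s * genGroup.r r s) = 1 :=
      Subtype.ext h2
    simp only [Equiv.coe_mulLeft, ← mul_assoc] at h3 ⊢
    rw [h3, one_mul]
  rev_ne x hx := by
    have h1 : genGroup.s r s * genGroup.r r s = 1 := mul_eq_right.mp hx
    have h2 : s * r = 1 := congrArg Subtype.val h1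
    rw [h2, orderOf_one] at h
    omega
  connected x y := by
    set S := genGroup.s r s
    set R := genGroup.r r s
    set H := Subgroup.closure {Equiv.mulLeft S, Equiv.mulLeft (S * R)}
    have hS : MulAction.toPermHom _ _ S ∈ H := Subgroup.subset_closure (Or.inl rfl)
    have hT : MulAction.toPermHom _ _ (S * R) ∈ H := Subgroup.subset_closure (Or.inr rfl)
    have hR : MulAction.toPermHom _ _ R ∈ H := by
      have := H.mul_mem (H.inv_mem hS) hT
      rwa [map_mul, inv_mul_cancel_left] at this
    have hle : (⊤ : Subgroup (genGroup r s)) ≤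
        H.comap (MulAction.toPermHom (genGroup r s) (genGroup r s)) := by
      rw [← genGroup_closure, Subgroup.closure_le]
      rintro z (rfl | rfl)
      · exact hR
      · exact hS
    exact ⟨_, hle (Subgroup.mem_top (y * x⁻¹)), by simp⟩
  nonempty := ⟨1⟩

end ofPerms

/-! ## The construction -/

/-- The points of a diagram: `num j` and `num' j` are the points labelled `j + 1` and `(j + 1)'`
for `j = 0, …, 2a - 1`; the other points carry the labels from `L`. -/
inductive Point (a : ℕ) (L : Type) : Type
  | num (j : Fin (2 * a))
  | num' (j : Fin (2 * a))
  | letter (l : L)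
  deriving DecidableEq, Fintype

/-- The list of points `1, 2, …, 2a`. -/
def ascending (a : ℕ) (L : Type) : List (Point a L) :=
  (List.finRange (2 * a)).map Point.num

/-- The list of points `(2a)', (2a-1)', …, 2', 1'`. -/
def descending' (a : ℕ) (L : Type) : List (Point a L) :=
  ((List.finRange (2 * a)).map Point.num').reverse

/-- The points that carry Greek letters when `i = -1`. -/
inductive LetterMinus : Type
  | alpha | alpha' | beta | beta' | gamma | gamma' | delta | delta' | epsilon | zeta
  deriving DecidableEq

instance : Fintype LetterMinus where
  elems := {.alpha, .alpha', .beta, .beta', .gamma, .gamma', .delta, .delta', .epsilon, .zeta}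
  complete x := by cases x <;> decide

/-- The points that carry Greek letters when `i = 1`. -/
inductive LetterPlus : Type
  | alpha | alpha' | beta | beta' | gamma | gamma' | delta | delta' | epsilon | zeta | eta
  deriving DecidableEq

instance : Fintype LetterPlus where
  elems := {.alpha, .alpha', .beta, .beta', .gamma, .gamma', .delta, .delta', .epsilon, .zeta, .eta}
  complete x := by cases x <;> decide

/-- `(1,1')(2,2')⋯(2a,(2a)')`, the identity when `a = 0`. -/
def tNum (a : ℕ) (L : Type) [DecidableEq L] : Perm (Point a L) :=
  ((List.finRange (2 * a)).map fun j => swap (Point.num j) (Point.num' j)).prod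

namespace Minus

open Point LetterMinus

/-- `s₋₁ = (1,…,2a,α,γ,ε,(2a)',…,1',δ,ζ,δ')(α',β)`. -/
def s (a : ℕ) : Perm (Point a LetterMinus) :=
  List.formPerm (ascending a _ ++ [letter alpha, letter gamma, letter epsilon] ++
    descending' a _ ++ [letter delta, letter zeta, letter delta']) *
  swap (letter alpha') (letter beta)

/-- `t = t_a (α,α')(β,β')(γ,γ')(δ,δ')`. -/
def t (a : ℕ) : Perm (Point a LetterMinus) :=
  tNum a _ * swap (letter alpha) (letter alpha') * swap (letter beta) (letter beta') *
    swap (letter gamma) (letter gamma') * swap (letter delta) (letter delta')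

/-- `r = t s⁻¹`, first `t` and then `s⁻¹`. -/
def r (a : ℕ) : Perm (Point a LetterMinus) := (s a)⁻¹ * t a

end Minus

namespace Plus

open Point LetterPlus

/-- `s₁ = (1,…,2a,α,β,γ,γ',ε,(2a)',…,1',δ,ζ,δ')(α',η)`. -/
def s (a : ℕ) : Perm (Point a LetterPlus) :=
  List.formPerm (ascending a _ ++
    [letter alpha, letter beta, letter gamma, letter gamma', letter epsilon] ++
    descending' a _ ++ [letter delta, letter zeta, letter delta']) *
  swap (letter alpha') (letter eta)

/-- `t = t_a (α,α')(β,β')(γ,γ')(δ,δ')`. -/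
def t (a : ℕ) : Perm (Point a LetterPlus) :=
  tNum a _ * swap (letter alpha) (letter alpha') * swap (letter beta) (letter beta') *
    swap (letter gamma) (letter gamma') * swap (letter delta) (letter delta')

/-- `r = t s⁻¹`, first `t` and then `s⁻¹`. -/
def r (a : ℕ) : Perm (Point a LetterPlus) := (s a)⁻¹ * t a

end Plus

/-! The permutation `t = r s` is an involution, as is needed for `M(G : r, s)` to be a map. -/

theorem swap_list_prod_apply_of_ne {X ι : Type*} [DecidableEq X] (u v : ι → X) (x : X)
    (l : List ι) (hu : ∀ j, u j ≠ x) (hv : ∀ j, v j ≠ x) :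
    (l.map fun j => swap (u j) (v j)).prod x = x := by
  induction l with
  | nil => rfl
  | cons j l ih =>
    rw [List.map_cons, List.prod_cons, Perm.mul_apply, ih]
    exact swap_apply_of_ne_of_ne (hu j).symm (hv j).symm

theorem tNum_letter (a : ℕ) (L : Type) [DecidableEq L] (l : L) :
    tNum a L (Point.letter l) = Point.letter l :=
  swap_list_prod_apply_of_ne _ _ _ _ (by simp) (by simp)

theorem swap_list_prod_num {a : ℕ} {L : Type} [DecidableEq L] (j : Fin (2 * a))
    (l : List (Fin (2 * a))) (hl : l.Nodup) :
    (l.map fun j => swap (Point.num j : Point a L) (Point.num' j)).prod (Point.num j) =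
      (if j ∈ l then Point.num' j else Point.num j) ∧
    (l.map fun j => swap (Point.num j : Point a L) (Point.num' j)).prod (Point.num' j) =
      (if j ∈ l then Point.num j else Point.num' j) := by
  induction l with
  | nil => simp
  | cons i l ih =>
    obtain ⟨h1, h2⟩ := ih (List.nodup_cons.mp hl).2
    have hi := (List.nodup_cons.mp hl).1
    simp only [List.map_cons, List.prod_cons, Perm.mul_apply, h1, h2, List.mem_cons]
    by_cases hj : j ∈ l
    · have hji : j ≠ i := by rintro rfl; exact hi hj
      simp [hj, swap_apply_def, hji]
    · by_cases hji : j = i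
      · subst hji; simp [hj]
      · simp [hj, swap_apply_def, hji]

theorem tNum_num (a : ℕ) (L : Type) [DecidableEq L] (j : Fin (2 * a)) :
    tNum a L (Point.num j) = Point.num' j := by
  simpa [tNum] using (swap_list_prod_num (L := L) j _ (List.nodup_finRange (2 * a))).1

theorem tNum_num' (a : ℕ) (L : Type) [DecidableEq L] (j : Fin (2 * a)) :
    tNum a L (Point.num' j) = Point.num j := by
  simpa [tNum] using (swap_list_prod_num (L := L) j _ (List.nodup_finRange (2 * a))).2

theorem Minus.orderOf_t (a : ℕ) : orderOf (Minus.t a) = 2 := by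
  refine orderOf_eq_prime ?_ ?_
  · ext x
    rcases x with j | j | l
    · simp [sq, Minus.t, tNum_num, tNum_num', swap_apply_def]
    · simp [sq, Minus.t, tNum_num, tNum_num', swap_apply_def]
    · cases l <;> simp [sq, Minus.t, tNum_letter, swap_apply_def]
  · intro h
    have := congrArg (fun p => p (Point.letter LetterMinus.alpha)) h
    simp [Minus.t, tNum_letter, swap_apply_def] at this

theorem Plus.orderOf_t (a : ℕ) : orderOf (Plus.t a) = 2 := by
  refine orderOf_eq_prime ?_ ?_
  · ext x
    rcases x with j | j | l
    · simp [sq, Plus.t, tNum_num, tNum_num', swap_apply_def]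
    · simp [sq, Plus.t, tNum_num, tNum_num', swap_apply_def]
    · cases l <;> simp [sq, Plus.t, tNum_letter, swap_apply_def]
  · intro h
    have := congrArg (fun p => p (Point.letter LetterPlus.alpha)) h
    simp [Plus.t, tNum_letter, swap_apply_def] at this

/-- The map `M(G : r, s)` of the construction when `i = -1`. -/
def Minus.map (a : ℕ) : OrientedMap (genGroup (Minus.r a) (Minus.s a)) :=
  mapOfPerms (Minus.r a) (Minus.s a) (by rw [Minus.r, mul_inv_cancel_left, Minus.orderOf_t])

/-- The map `M(G : r, s)` of the construction when `i = 1`. -/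
def Plus.map (a : ℕ) : OrientedMap (genGroup (Plus.r a) (Plus.s a)) :=
  mapOfPerms (Plus.r a) (Plus.s a) (by rw [Plus.r, mul_inv_cancel_left, Plus.orderOf_t])

/-! Right translations of `G` commute with the left multiplications defining the map, so the map is
orientably regular, and its face lengths and valencies are the orders of `r` and `s`. The
permutation `r` has one 8-cycle and otherwise only cycles of length 1 or 2, while `s` is a cycle of
even length `n` times a disjoint transposition; this gives the type.

Since `r ^ 4` is a product of four disjoint transpositions, so is each of its conjugates. The two
involutions multiplied in `chiralWord` form a graph whose components are paths, apart from one
common transposition that cancels; a path with `p` vertices contributes a `p`-cycle to the product.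
For `s` and `t` the nontrivial cycles have lengths 3 and 5, so the fifth power is a 3-cycle. With
`s⁻¹` in place of `s` they have lengths 4 and 6 (`Minus`), or 3 and 7 (`Plus`), so the cube of the
word is not 1.

The word therefore serves twice. A reflection would induce an endomorphism with `s ↦ s⁻¹` and `t ↦
t` (`exists_monoidHom_of_isReflection`), which must preserve the relation that the cube is 1: hence
chirality (`mapOfPerms_isChiral`). And a primitive group containing a 3-cycle contains the
alternating group (`genGroup_eq_alternatingGroup`); equality holds because `r` and `s` are even.
Primitivity follows by examining blocks through a fixed point of `s`. -/

/-! ### Cycles given by lists, and periods of translations -/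

theorem List.formPerm_apply_of_getElem? {α : Type*} [DecidableEq α] {l : List α} (hl : l.Nodup)
    {x y : α} (i : ℕ) (hx : l[i]? = some x) (hy : l[i + 1]? = some y) : l.formPerm x = y := by
  obtain ⟨h1, rfl⟩ := List.getElem?_eq_some_iff.mp hx
  obtain ⟨h2, rfl⟩ := List.getElem?_eq_some_iff.mp hy
  exact List.formPerm_apply_lt_getElem l hl i h2

theorem List.formPerm_apply_of_getElem?_last {α : Type*} [DecidableEq α] {l : List α}
    (hl : l.Nodup) {x y : α} (i : ℕ) (hi : i + 1 = l.length) (hx : l[i]? = some x)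
    (hy : l[0]? = some y) : l.formPerm x = y := by
  obtain ⟨h1, rfl⟩ := List.getElem?_eq_some_iff.mp hx
  obtain ⟨h2, rfl⟩ := List.getElem?_eq_some_iff.mp hy
  rw [List.formPerm_apply_getElem l hl i h1]
  simp [hi]

theorem List.orderOf_formPerm_of_nodup {α : Type*} [DecidableEq α] [Fintype α] {l : List α}
    (hl : l.Nodup) (h2 : 2 ≤ l.length) : orderOf l.formPerm = l.length := by
  rw [(List.isCycle_formPerm hl h2).orderOf, List.support_formPerm_of_nodup _ hl,
    List.toFinset_card_of_nodup hl]
  rintro x rfl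
  simp at h2

theorem List.sign_formPerm_of_nodup {α : Type*} [DecidableEq α] [Fintype α] {l : List α}
    (hl : l.Nodup) (h2 : 2 ≤ l.length) : Perm.sign l.formPerm = -(-1) ^ l.length := by
  rw [(List.isCycle_formPerm hl h2).sign, ← (List.isCycle_formPerm hl h2).orderOf,
    List.orderOf_formPerm_of_nodup hl h2]

/-- Translations act freely: the orbit of `x` closes up after `k` steps exactly when `g ^ k = 1`,
whatever `x` is. -/
theorem Function.minimalPeriod_mulLeft {G : Type*} [Group G] (g x : G) :
    Function.minimalPeriod (Equiv.mulLeft g) x = orderOf g := by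
  have h (k : ℕ) : (⇑(Equiv.mulLeft g))^[k] x = g ^ k * x := by
    induction k with
    | zero => simp
    | succ k ih => rw [Function.iterate_succ_apply', ih, pow_succ', mul_assoc]; rfl
  refine Nat.dvd_antisymm ?_ ?_
  · apply Function.IsPeriodicPt.minimalPeriod_dvd
    rw [Function.IsPeriodicPt, Function.IsFixedPt, h, pow_orderOf_eq_one, one_mul]
  · apply orderOf_dvd_of_pow_eq_one
    have := Function.isPeriodicPt_minimalPeriod (Equiv.mulLeft g) x
    rw [Function.IsPeriodicPt, Function.IsFixedPt, h] at this
    exact mul_eq_right.mp this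

/-! ### Regularity, type and chirality of the map of a pair -/

section mapOfPerms

variable {X : Type*} {r s : Perm X}

theorem mapOfPerms_isOrientablyRegular (h : orderOf (s * r) = 2) :
    (mapOfPerms r s h).IsOrientablyRegular := fun x y =>
  ⟨Equiv.mulRight (x⁻¹ * y), ⟨fun z => mul_assoc _ _ _, fun z => mul_assoc _ _ _⟩, by simp⟩

theorem mapOfPerms_hasType (h : orderOf (s * r) = 2) :
    (mapOfPerms r s h).HasType (orderOf r) (orderOf s) := by
  refine ⟨fun x => ?_, fun x => ?_⟩
  · have : (mapOfPerms r s h).face = Equiv.mulLeft (genGroup.r r s) := by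
      ext1 x
      simp [OrientedMap.face, mapOfPerms, mul_assoc]
    rw [this, Function.minimalPeriod_mulLeft, ← Subgroup.orderOf_coe]
    rfl
  · exact (Function.minimalPeriod_mulLeft _ _).trans (Subgroup.orderOf_coe _).symm

/-- A reflection of the map of `r` and `s` induces an endomorphism of `⟨r, s⟩` that inverts `s` and
fixes the involution. -/
theorem exists_monoidHom_of_isReflection (h : orderOf (s * r) = 2)
    {f : Perm (genGroup r s)} (hf : (mapOfPerms r s h).IsReflection f) :
    ∃ φ : genGroup r s →* genGroup r s, φ (genGroup.s r s) = (genGroup.s r s)⁻¹ ∧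
      φ (genGroup.s r s * genGroup.r r s) = genGroup.s r s * genGroup.r r s := by
  set S := genGroup.s r s with hS
  set R := genGroup.r r s with hR
  have fS (x) : f (S * x) = S⁻¹ * f x := hf.1 x
  have fT (x) : f (S * R * x) = S * R * f x := hf.2 x
  -- `f` intertwines left multiplication by each generator with some left multiplication, and this
  -- property passes to products and inverses.
  have key (u : genGroup r s) : ∃ v, ∀ x, f (u * x) = v * f x := by
    have hu : u ∈ Subgroup.closure {R, S} := by rw [genGroup_closure]; trivial
    induction hu using Subgroup.closure_induction with
    | mem u hu =>
      rcases hu with rfl | rfl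
      -- Comparing `fT` at `x` with `fS` at `R * x` gives `S * R * f x = S⁻¹ * f (R * x)`.
      · refine ⟨S * (S * R), fun x => ?_⟩
        have := fS (R * x)
        rw [← mul_assoc, fT] at this
        rw [mul_assoc S, this, mul_inv_cancel_left]
      · exact ⟨_, fS⟩
    | one => exact ⟨1, by simp⟩
    | mul u u' _ _ h h' =>
      obtain ⟨v, hv⟩ := h
      obtain ⟨v', hv'⟩ := h'
      exact ⟨v * v', fun x => by rw [mul_assoc, hv, hv', mul_assoc]⟩
    | inv u _ h =>
      obtain ⟨v, hv⟩ := h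
      exact ⟨v⁻¹, fun x => by rw [eq_inv_mul_iff_mul_eq, ← hv, mul_inv_cancel_left]⟩
  have hφ (u x) : f (u * x) = f u * (f 1)⁻¹ * f x := by
    obtain ⟨v, hv⟩ := key u
    have h1 := hv 1
    rw [mul_one] at h1
    rw [hv, h1, mul_inv_cancel_right]
  -- A reflection need not fix the arc `1`; dividing by `f 1` corrects for this.
  refine ⟨MonoidHom.mk' (fun u => f u * (f 1)⁻¹) fun u v => ?_, ?_, ?_⟩
  · rw [hφ u v]; simp only [mul_assoc]
  · have := fS 1
    rw [mul_one] at this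
    simp [this]
  · have := fT 1
    rw [mul_one] at this
    simp [this]

/-- A word in `s` and `t` that is a 3-cycle in the groups of the construction, but does not have
order 3 after `s` is replaced by its inverse. -/
def chiralWord {G : Type*} [Group G] (s t : G) : G :=
  ((s⁻¹ * t) ^ 4 * (s * t * s⁻¹ * t * s⁻¹ * (s⁻¹ * t) ^ 4 * (s * t * s⁻¹ * t * s⁻¹)⁻¹)) ^ 5

theorem map_chiralWord {G H : Type*} [Group G] [Group H] (φ : G →* H) (s t : G) :
    φ (chiralWord s t) = chiralWord (φ s) (φ t) := by
  simp [chiralWord]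

theorem chiralWord_mem_genGroup : chiralWord s (s * r) ∈ genGroup r s := by
  have := (chiralWord (genGroup.s r s) (genGroup.s r s * genGroup.r r s)).2
  rwa [← Subgroup.subtype_apply, map_chiralWord] at this

theorem mapOfPerms_isChiral (h : orderOf (s * r) = 2)
    (h1 : chiralWord s (s * r) ^ 3 = 1) (h2 : chiralWord s⁻¹ (s * r) ^ 3 ≠ 1) :
    (mapOfPerms r s h).IsChiral := by
  refine ⟨mapOfPerms_isOrientablyRegular h, fun ⟨f, hf⟩ => h2 ?_⟩
  obtain ⟨φ, hs, ht⟩ := exists_monoidHom_of_isReflection h hf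
  have h3 : chiralWord (genGroup.s r s) (genGroup.s r s * genGroup.r r s) ^ 3 = 1 := by
    apply Subgroup.subtype_injective
    rw [map_pow, map_chiralWord, map_one]
    exact h1
  have h4 := congrArg ((genGroup r s).subtype.comp φ) h3
  rw [MonoidHom.comp_apply, map_pow, map_chiralWord, hs, ht, map_pow, map_chiralWord, map_one] at h4
  exact h4

end mapOfPerms

/-! ### Transport and conjugation of transpositions -/

section swaps

variable {α β : Type*} [DecidableEq α] [DecidableEq β]

/-- The words to be studied move at most eleven points, independently of `a`. This lemma moves them
to `Perm (Fin 11)`, where they can be evaluated by decision. -/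
theorem Equiv.Perm.viaEmbeddingHom_swap (e : α ↪ β) (x y : α) :
    Perm.viaEmbeddingHom e (swap x y) = swap (e x) (e y) := by
  ext z
  by_cases hz : z ∈ Set.range e
  · obtain ⟨w, rfl⟩ := hz
    rw [Perm.viaEmbeddingHom_apply, Perm.viaEmbedding_apply, e.injective.map_swap]
  · rw [Perm.viaEmbeddingHom_apply, Perm.viaEmbedding_apply_of_notMem _ _ _ hz,
      swap_apply_of_ne_of_ne] <;> (rintro rfl; exact hz ⟨_, rfl⟩)

theorem Equiv.Perm.conj_four_swaps (g : Perm α) (a b c d e f i j : α) :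
    g * (swap a b * swap c d * swap e f * swap i j) * g⁻¹ =
      swap (g a) (g b) * swap (g c) (g d) * swap (g e) (g f) * swap (g i) (g j) := by
  simp only [swap_apply_apply]
  group

end swaps

/-! ### Numbered points -/

section points

variable {a : ℕ} {L : Type}

theorem length_ascending : (ascending a L).length = 2 * a := by simp [ascending]

theorem length_descending' : (descending' a L).length = 2 * a := by simp [descending']

theorem getElem?_ascending (j : Fin (2 * a)) :
    (ascending a L)[(j : ℕ)]? = some (Point.num j) := by
  simp [ascending]

theorem getElem?_descending' (j : Fin (2 * a)) {k : ℕ} (hk : k + j + 1 = 2 * a) :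
    (descending' a L)[k]? = some (Point.num' j) := by
  have h : k < (descending' a L).length := by rw [length_descending']; omega
  rw [List.getElem?_eq_getElem h]
  simp only [descending', List.getElem_reverse, List.getElem_map, List.length_map,
    List.length_finRange, List.getElem_finRange]
  refine congrArg some (congrArg Point.num' (Fin.ext ?_))
  simp
  omega

theorem mem_ascending {x : Point a L} : x ∈ ascending a L ↔ ∃ j, Point.num j = x := by
  simp [ascending]

theorem mem_descending' {x : Point a L} : x ∈ descending' a L ↔ ∃ j, Point.num' j = x := by
  simp [descending']

theorem nodup_ascending : (ascending a L).Nodup :=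
  (List.nodup_finRange _).map fun _ _ h => by simpa using h

theorem nodup_descending' : (descending' a L).Nodup :=
  List.nodup_reverse.mpr ((List.nodup_finRange _).map fun _ _ h => by simpa using h)

/-- The number `2 * a` of transpositions is even. -/
theorem sign_tNum [DecidableEq L] [Fintype L] : Perm.sign (tNum a L) = 1 := by
  have h : (List.finRange (2 * a)).map (fun j => Perm.sign
      (swap (Point.num j : Point a L) (Point.num' j))) = List.replicate (2 * a) (-1) := by
    rw [List.eq_replicate_iff]
    refine ⟨by simp, ?_⟩
    intro u hu
    obtain ⟨j, -, rfl⟩ := List.mem_map.mp hu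
    exact Perm.sign_swap (by simp)
  rw [tNum, map_list_prod, List.map_map]
  exact (congrArg List.prod h).trans (by simp [pow_mul])

end points

/-! ### Primitivity and the alternating group -/

open scoped Pointwise in
/-- A transitive permutation group is primitive if every block that contains a given point and
some other one is the set of all points. -/
theorem Subgroup.isPreprimitive_of_forall_block {X : Type*} {G : Subgroup (Perm X)} (x₀ : X)
    (htrans : ∀ S : Set X, x₀ ∈ S → (∀ g ∈ G, ∀ z, z ∈ S ↔ g z ∈ S) → S = Set.univ)
    (hblock : ∀ B : Set X, x₀ ∈ B → (∀ g ∈ G, ∀ y ∈ B, g y ∈ B → ∀ z, z ∈ B ↔ g z ∈ B) →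
      ∀ z ∈ B, z ≠ x₀ → B = Set.univ) : MulAction.IsPreprimitive G X := by
  have : MulAction.IsPretransitive G X := by
    rw [MulAction.isPretransitive_iff_base x₀]
    intro x
    -- Transitivity is the assumption on invariant sets applied to the orbit of `x₀`.
    have h := htrans (MulAction.orbit G x₀) (MulAction.mem_orbit_self _) fun g hg z =>
      ⟨fun h => MulAction.mem_orbit_of_mem_orbit (⟨g, hg⟩ : G) h, fun h => by
        have := MulAction.mem_orbit_of_mem_orbit (⟨g, hg⟩ : G)⁻¹ h
        rwa [← Perm.smul_def, ← Subgroup.mk_smul g hg, inv_smul_smul] at this⟩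
    have hx : x ∈ MulAction.orbit G x₀ := h ▸ Set.mem_univ x
    exact hx
  refine MulAction.IsPreprimitive.of_isTrivialBlock_base x₀ fun {B} hx hB => ?_
  by_cases h : ∃ z ∈ B, z ≠ x₀
  · obtain ⟨z, hz, hne⟩ := h
    refine Or.inr (hblock B hx (fun g hg y hy hgy w => ?_) z hz hne)
    -- The translate of the block meets the block in `g y`, so the two coincide.
    have h1 : (⟨g, hg⟩ : G) • B = B := by
      have := MulAction.isBlock_iff_smul_eq_smul_of_nonempty.mp hB (g₁ := ⟨g, hg⟩) (g₂ := 1)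
        ⟨g y, Set.smul_mem_smul_set hy, by simpa only [one_smul] using hgy⟩
      simpa using this
    conv_rhs => rw [← h1]
    exact (Set.smul_mem_smul_set_iff (a := (⟨g, hg⟩ : G))).symm
  · push Not at h
    exact Or.inl fun x hx y hy => (h x hx).trans (h y hy).symm

theorem List.mem_iff_of_forall_getElem? {α : Type*} {l : List α} {f : α → α}
    (hf : ∀ i x y, l[i]? = some x → l[i + 1]? = some y → f x = y) {S : Set α}
    (hS : ∀ z, z ∈ S ↔ f z ∈ S) {x y : α} (hx : x ∈ l) (hy : y ∈ l) : x ∈ S ↔ y ∈ S := by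
  have key (i : ℕ) (h : i < l.length) : l[i] ∈ S ↔ l[0] ∈ S := by
    induction i with
    | zero => rfl
    | succ i ih =>
      rw [← ih (by omega), hS l[i], hf i l[i] l[i + 1] (by simp) (by simp)]
  obtain ⟨i, hi, rfl⟩ := List.getElem_of_mem hx
  obtain ⟨j, hj, rfl⟩ := List.getElem_of_mem hy
  rw [key i hi, key j hj]

/-- Jordan's theorem on primitive groups with a 3-cycle gives one inclusion, the signs of the
generators the other. -/
theorem genGroup_eq_alternatingGroup {X : Type*} [Fintype X] [DecidableEq X] {r s : Perm X}
    (hprim : MulAction.IsPreprimitive (genGroup r s) X)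
    (h3 : (chiralWord s (s * r)).IsThreeCycle) (hr : Perm.sign r = 1) (hs : Perm.sign s = 1) :
    genGroup r s = alternatingGroup X := by
  refine le_antisymm ?_ ?_
  · rw [genGroup, Subgroup.closure_le]
    rintro x (rfl | rfl)
    · exact hr
    · exact hs
  · exact Perm.alternatingGroup_le_of_isPreprimitive_of_isThreeCycle_mem hprim h3
      chiralWord_mem_genGroup

/-- If `t` is an involution, replacing `s` by its inverse conjugates `(s⁻¹ * t) ^ 4` by `t`, up to
inversion. -/
theorem inv_inv_mul_pow_four {G : Type*} [Group G] {s t : G} (ht : t * t = 1)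
    (hx : (s⁻¹ * t) ^ 4 * (s⁻¹ * t) ^ 4 = 1) :
    (s⁻¹⁻¹ * t) ^ 4 = t * (s⁻¹ * t) ^ 4 * t⁻¹ := by
  have ht' : t⁻¹ = t := inv_eq_of_mul_eq_one_left ht
  -- The fourth power is its own inverse, so it suffices that `s * t` is the conjugate by `t` of
  -- `(s⁻¹ * t)⁻¹`.
  rw [← inv_eq_of_mul_eq_one_left hx, ← inv_pow, ← conj_pow]
  simp only [mul_inv_rev, ht', inv_inv]
  rw [← mul_assoc, ht, one_mul]

/-! ### Case `i = -1`: action of `s` and `t` on the points -/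

namespace Minus

open Point LetterMinus

variable {a : ℕ}

/-- The points of the long cycle of `s`, in cyclic order. -/
def cycleList (a : ℕ) : List (Point a LetterMinus) :=
  ascending a _ ++ [letter alpha, letter gamma, letter epsilon] ++
    descending' a _ ++ [letter delta, letter zeta, letter delta']

theorem length_cycleList : (cycleList a).length = 4 * a + 6 := by
  simp [cycleList, length_ascending, length_descending']; omega

theorem nodup_cycleList : (cycleList a).Nodup := by
  simp only [cycleList, List.nodup_append, nodup_ascending, nodup_descending',
    List.mem_append, mem_ascending, mem_descending']
  simp
  grind

theorem s_eq : s a = (cycleList a).formPerm * swap (letter alpha') (letter beta) := rfl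

theorem notMem_alpha' : (letter alpha' : Point a LetterMinus) ∉ cycleList a := by
  simp [cycleList, mem_ascending, mem_descending']

theorem notMem_beta : (letter beta : Point a LetterMinus) ∉ cycleList a := by
  simp [cycleList, mem_ascending, mem_descending']

theorem s_apply_of_getElem? {x y : Point a LetterMinus} (i : ℕ) (hx : (cycleList a)[i]? = some x)
    (hy : (cycleList a)[i + 1]? = some y) : s a x = y := by
  have hm := List.mem_of_getElem? hx
  rw [s_eq, Perm.mul_apply, swap_apply_of_ne_of_ne]
  · exact List.formPerm_apply_of_getElem? nodup_cycleList i hx hy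
  · rintro rfl; exact notMem_alpha' hm
  · rintro rfl; exact notMem_beta hm

theorem getElem?_num (j : Fin (2 * a)) : (cycleList a)[(j : ℕ)]? = some (num j) := by
  rw [cycleList, List.append_assoc, List.append_assoc,
    List.getElem?_append_left (by rw [length_ascending]; exact j.2), getElem?_ascending]

theorem getElem?_letter (k : ℕ) (hk : k < 3) : (cycleList a)[2 * a + k]? =
    [letter alpha, letter gamma, letter epsilon][k]? := by
  rw [cycleList, List.append_assoc, List.append_assoc,
    List.getElem?_append_right (by rw [length_ascending]; omega),
    List.getElem?_append_left (by simp [length_ascending, hk]), length_ascending]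
  simp

theorem getElem?_num' (k : ℕ) (j : Fin (2 * a)) (hk : k + j + 1 = 2 * a) :
    (cycleList a)[2 * a + 3 + k]? = some (num' j) := by
  rw [cycleList, List.getElem?_append_left, List.getElem?_append_right]
  · rw [← getElem?_descending' j hk]
    simp [length_ascending]
  · simp [length_ascending]
  · simp [length_ascending, length_descending']; omega

theorem getElem?_letter' (k : ℕ) : (cycleList a)[4 * a + 3 + k]? =
    [letter delta, letter zeta, letter delta'][k]? := by
  rw [cycleList, List.getElem?_append_right]
  · simp [length_ascending, length_descending']; congr 1; omega
  · simp [length_ascending, length_descending']; omega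

theorem s_num (j : ℕ) (h : j + 1 < 2 * a) :
    s a (num ⟨j, Nat.lt_of_succ_lt h⟩) = num ⟨j + 1, h⟩ :=
  s_apply_of_getElem? j (getElem?_num ⟨j, Nat.lt_of_succ_lt h⟩) (getElem?_num ⟨j + 1, h⟩)

theorem s_num_last (j : ℕ) (h : j < 2 * a) (h' : j + 1 = 2 * a) :
    s a (num ⟨j, h⟩) = letter alpha :=
  s_apply_of_getElem? j (getElem?_num ⟨j, h⟩) (by rw [h']; exact getElem?_letter 0 (by omega))

theorem s_alpha : s a (letter alpha) = letter gamma :=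
  s_apply_of_getElem? _ (getElem?_letter 0 (by omega)) (getElem?_letter 1 (by omega))

theorem s_gamma : s a (letter gamma) = letter epsilon :=
  s_apply_of_getElem? _ (getElem?_letter 1 (by omega)) (getElem?_letter 2 (by omega))

theorem s_epsilon (j : ℕ) (h : j < 2 * a) (h' : j + 1 = 2 * a) :
    s a (letter epsilon) = num' ⟨j, h⟩ :=
  s_apply_of_getElem? _ (getElem?_letter 2 (by omega))
    (getElem?_num' 0 ⟨j, h⟩ (by simp only; omega))

theorem s_num' (j : ℕ) (h : j + 1 < 2 * a) :
    s a (num' ⟨j + 1, h⟩) = num' ⟨j, Nat.lt_of_succ_lt h⟩ :=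
  s_apply_of_getElem? _ (getElem?_num' (2 * a - j - 2) ⟨j + 1, h⟩ (by simp only; omega))
    (getElem?_num' (2 * a - j - 2 + 1) ⟨j, Nat.lt_of_succ_lt h⟩ (by simp only; omega))

theorem s_num'_zero (h : 0 < 2 * a) : s a (num' ⟨0, h⟩) = letter delta := by
  refine s_apply_of_getElem? _ (getElem?_num' (2 * a - 1) ⟨0, h⟩ (by simp only; omega)) ?_
  rw [show 2 * a + 3 + (2 * a - 1) + 1 = 4 * a + 3 + 0 by omega, getElem?_letter']
  rfl

theorem s_delta : s a (letter delta) = letter zeta :=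
  s_apply_of_getElem? _ (getElem?_letter' 0) (getElem?_letter' 1)

theorem s_zeta : s a (letter zeta) = letter delta' :=
  s_apply_of_getElem? _ (getElem?_letter' 1) (getElem?_letter' 2)

theorem s_delta' (h : 0 < 2 * a) : s a (letter delta') = num ⟨0, h⟩ := by
  rw [s_eq, Perm.mul_apply, swap_apply_of_ne_of_ne (by simp) (by simp)]
  exact List.formPerm_apply_of_getElem?_last nodup_cycleList (4 * a + 3 + 2)
    (by rw [length_cycleList]) (getElem?_letter' 2) (getElem?_num ⟨0, h⟩)

theorem s_of_notMem {x : Point a LetterMinus} (h : x ∉ cycleList a) :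
    s a x = swap (letter alpha') (letter beta) x := by
  rw [s_eq, Perm.mul_apply, List.formPerm_apply_of_notMem]
  rw [swap_apply_def]
  split_ifs
  exacts [notMem_beta, notMem_alpha', h]

theorem s_alpha' : s a (letter alpha') = letter beta := by
  simp [s_of_notMem notMem_alpha']

theorem s_beta : s a (letter beta) = letter alpha' := by
  simp [s_of_notMem notMem_beta]

theorem s_beta' : s a (letter beta') = letter beta' := by
  rw [s_of_notMem (by simp [cycleList, mem_ascending, mem_descending'])]
  simp [swap_apply_def]

theorem s_gamma' : s a (letter gamma') = letter gamma' := by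
  rw [s_of_notMem (by simp [cycleList, mem_ascending, mem_descending'])]
  simp [swap_apply_def]

theorem disjoint : Perm.Disjoint (cycleList a).formPerm (swap (letter alpha') (letter beta)) := by
  intro x
  by_cases hx : x ∈ cycleList a
  · right
    apply swap_apply_of_ne_of_ne
    · rintro rfl; exact notMem_alpha' hx
    · rintro rfl; exact notMem_beta hx
  · exact Or.inl (List.formPerm_apply_of_notMem hx)

theorem orderOf_s : orderOf (s a) = 4 * a + 6 := by
  rw [s_eq, disjoint.orderOf, List.orderOf_formPerm_of_nodup nodup_cycleList, length_cycleList,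
    Perm.IsSwap.orderOf ⟨_, _, by simp, rfl⟩]
  · exact Nat.lcm_eq_left ⟨2 * a + 3, by omega⟩
  · rw [length_cycleList]; omega

/-- A cycle of even length and a transposition are both odd. -/
theorem sign_s : Perm.sign (s a) = 1 := by
  rw [s_eq, map_mul, List.sign_formPerm_of_nodup nodup_cycleList, length_cycleList,
    Perm.sign_swap (by simp)]
  · rw [Even.neg_one_pow ⟨2 * a + 3, by omega⟩]; rfl
  · rw [length_cycleList]; omega

theorem t_num (j : Fin (2 * a)) : t a (num j) = num' j := by
  simp [t, tNum_num, swap_apply_def]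

theorem t_num' (j : Fin (2 * a)) : t a (num' j) = num j := by
  simp [t, tNum_num', swap_apply_def]

theorem t_alpha : t a (letter alpha) = letter alpha' := by simp [t, tNum_letter, swap_apply_def]
theorem t_alpha' : t a (letter alpha') = letter alpha := by simp [t, tNum_letter, swap_apply_def]
theorem t_beta : t a (letter beta) = letter beta' := by simp [t, tNum_letter, swap_apply_def]
theorem t_beta' : t a (letter beta') = letter beta := by simp [t, tNum_letter, swap_apply_def]
theorem t_gamma : t a (letter gamma) = letter gamma' := by simp [t, tNum_letter, swap_apply_def]
theorem t_gamma' : t a (letter gamma') = letter gamma := by simp [t, tNum_letter, swap_apply_def]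
theorem t_delta : t a (letter delta) = letter delta' := by simp [t, tNum_letter, swap_apply_def]
theorem t_delta' : t a (letter delta') = letter delta := by simp [t, tNum_letter, swap_apply_def]
theorem t_epsilon : t a (letter epsilon) = letter epsilon := by
  simp [t, tNum_letter, swap_apply_def]
theorem t_zeta : t a (letter zeta) = letter zeta := by simp [t, tNum_letter, swap_apply_def]

theorem sign_t : Perm.sign (t a) = 1 := by
  simp [t, sign_tNum]

end Minus

/-! ### Case `i = -1`: primitivity, order of `r`, and the 3-cycle -/

namespace Minus

open Point LetterMinus

variable {a : ℕ}

theorem s_mul_r : s a * r a = t a := mul_inv_cancel_left _ _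

theorem t_mul_t : t a * t a = 1 := by
  rw [← sq, ← orderOf_t a, pow_orderOf_eq_one]

theorem r_apply {x y : Point a LetterMinus} (h : t a x = s a y) : r a x = y := by
  rw [r, Perm.mul_apply, h]; exact (s a).symm_apply_apply y

theorem s_inv_apply {x y : Point a LetterMinus} (h : s a y = x) : (s a)⁻¹ x = y := by
  rw [← h]; exact (s a).symm_apply_apply y

theorem mem_iff_of_mem_cycleList {S : Set (Point a LetterMinus)} (hs : ∀ z, z ∈ S ↔ s a z ∈ S)
    {x y : Point a LetterMinus} (hx : x ∈ cycleList a) (hy : y ∈ cycleList a) : x ∈ S ↔ y ∈ S :=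
  List.mem_iff_of_forall_getElem? (fun i _ _ => s_apply_of_getElem? i) hs hx hy

/-- The set contains the long cycle of `s` through `γ`. Outside it, `t` leads from the cycle to `α'`
and `γ'`, then `s` from `α'` to `β`, and `t` from `β` to `β'`. -/
theorem eq_univ_of_gamma_mem {S : Set (Point a LetterMinus)} (hs : ∀ z, z ∈ S ↔ s a z ∈ S)
    (ht : ∀ z, z ∈ S ↔ t a z ∈ S) (h : letter gamma ∈ S) : S = Set.univ := by
  have hc {x : Point a LetterMinus} (hx : x ∈ cycleList a) : x ∈ S :=
    (mem_iff_of_mem_cycleList hs hx (by simp [cycleList])).mpr h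
  have ha : letter alpha' ∈ S := by
    rw [← t_alpha, ← ht]; exact hc (by simp [cycleList])
  have hb : letter beta ∈ S := by rwa [← s_alpha', ← hs]
  ext x
  simp only [Set.mem_univ, iff_true]
  by_cases hx : x ∈ cycleList a
  · exact hc hx
  rcases x with j | j | l
  · simp [cycleList, mem_ascending] at hx
  · simp [cycleList, mem_descending'] at hx
  · cases l
    case alpha' => exact ha
    case beta => exact hb
    case beta' => rwa [← t_beta, ← ht]
    case gamma' => rwa [← t_gamma, ← ht]
    all_goals simp [cycleList] at hx

theorem isPreprimitive (ha : 0 < a) :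
    MulAction.IsPreprimitive (genGroup (r a) (s a)) (Point a LetterMinus) := by
  have hsG : s a ∈ genGroup (r a) (s a) := Subgroup.subset_closure (Or.inr rfl)
  have htG : t a ∈ genGroup (r a) (s a) := by
    rw [← s_mul_r]
    exact mul_mem hsG (Subgroup.subset_closure (Or.inl rfl))
  refine Subgroup.isPreprimitive_of_forall_block (letter gamma') (fun S hS h => ?_)
    fun B hB h z hz hne => ?_
  · refine eq_univ_of_gamma_mem (h _ hsG) (h _ htG) ?_
    rwa [h _ htG, t_gamma]
  -- The base point `γ'` was chosen because `s` fixes it: every block through it is invariant under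
  -- `s`.
  have hs := h _ hsG _ hB (by rwa [s_gamma'])
  have hc {x y : Point a LetterMinus} (hx : x ∈ cycleList a) (hy : y ∈ cycleList a) (h : x ∈ B) :
    y ∈ B := (mem_iff_of_mem_cycleList hs hx hy).mp h
  have hga (hg : letter gamma ∈ B) : B = Set.univ :=
    eq_univ_of_gamma_mem hs (h _ htG _ hB (by rwa [t_gamma'])) hg
  have hbeta (hb : letter beta ∈ B) : B = Set.univ := by
    -- `t s t` fixes `β`, because `s` fixes `β'`, and it moves `γ'` to `ε` on the long cycle.
    have h1 := (h (t a * s a * t a) (mul_mem (mul_mem htG hsG) htG) _ hb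
      (by simpa [t_beta, s_beta', t_beta'] using hb) (letter gamma')).mp hB
    simp only [Perm.mul_apply, t_gamma', s_gamma, t_epsilon] at h1
    exact hga (hc (by simp [cycleList]) (by simp [cycleList]) h1)
  by_cases hx : z ∈ cycleList a
  · exact hga (hc hx (by simp [cycleList]) hz)
  rcases z with j | j | l
  · simp [cycleList, mem_ascending] at hx
  · simp [cycleList, mem_descending'] at hx
  · cases l
    case alpha' => exact hbeta (by rwa [← s_alpha', ← hs])
    case beta => exact hbeta hz
    case beta' =>
      -- `t s² t` fixes `β'`, because `s` interchanges `β` and `α'`, and it moves `γ'` to the last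
      -- unprimed numbered point.
      have h1 := (h (t a * (s a * s a) * t a) (mul_mem (mul_mem htG (mul_mem hsG hsG)) htG) _ hz
        (by simpa [t_beta, s_beta, s_alpha', t_beta'] using hz) (letter gamma')).mp hB
      simp only [Perm.mul_apply, t_gamma', s_gamma,
        s_epsilon (a := a) (2 * a - 1) (by omega) (by omega), t_num'] at h1
      exact hga (hc (by simp [cycleList, mem_ascending]) (by simp [cycleList]) h1)
    case gamma' => exact absurd rfl hne
    all_goals simp [cycleList] at hx

/-- The 8-cycle of `r` is `(2a, ε, γ, γ', α, β, β', α')`, and its fourth power pairs opposite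
points. All other cycles are transpositions: `j` with `(j+1)'`, `1'` with `δ'`, and `δ` with `ζ`. -/
theorem r_pow_four (m : ℕ) (hm : m < 2 * a) (hm' : m + 1 = 2 * a) :
    ((s a)⁻¹ * t a) ^ 4 = swap (num ⟨m, hm⟩) (letter alpha) *
      swap (letter alpha') (letter gamma') * swap (letter beta) (letter epsilon) *
      swap (letter beta') (letter gamma) := by
  change r a ^ 4 = _
  have r_num (j : ℕ) (h : j + 1 < 2 * a) :
      r a (num ⟨j, Nat.lt_of_succ_lt h⟩) = num' ⟨j + 1, h⟩ := r_apply (by rw [t_num, s_num' j h])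
  have r_num_last : r a (num ⟨m, hm⟩) = letter epsilon :=
    r_apply (by rw [t_num, s_epsilon m hm hm'])
  have r_num' (j : ℕ) (h : j + 1 < 2 * a) :
      r a (num' ⟨j + 1, h⟩) = num ⟨j, Nat.lt_of_succ_lt h⟩ := r_apply (by rw [t_num', s_num j h])
  have r_num'_zero (h : 0 < 2 * a) : r a (num' ⟨0, h⟩) = letter delta' :=
    r_apply (by rw [t_num', s_delta'])
  have r_delta' (h : 0 < 2 * a) : r a (letter delta') = num' ⟨0, h⟩ :=
    r_apply (by rw [t_delta', s_num'_zero])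
  have r_delta : r a (letter delta) = letter zeta := r_apply (by rw [t_delta, s_zeta])
  have r_zeta : r a (letter zeta) = letter delta := r_apply (by rw [t_zeta, s_delta])
  have r_epsilon : r a (letter epsilon) = letter gamma := r_apply (by rw [t_epsilon, s_gamma])
  have r_gamma : r a (letter gamma) = letter gamma' := r_apply (by rw [t_gamma, s_gamma'])
  have r_gamma' : r a (letter gamma') = letter alpha := r_apply (by rw [t_gamma', s_alpha])
  have r_alpha : r a (letter alpha) = letter beta := r_apply (by rw [t_alpha, s_beta])
  have r_beta : r a (letter beta) = letter beta' := r_apply (by rw [t_beta, s_beta'])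
  have r_beta' : r a (letter beta') = letter alpha' := r_apply (by rw [t_beta', s_alpha'])
  have r_alpha' : r a (letter alpha') = num ⟨m, hm⟩ :=
    r_apply (by rw [t_alpha', s_num_last m hm hm'])
  have h0 : 0 < 2 * a := by omega
  ext x
  simp only [pow_succ, pow_zero, one_mul, Perm.mul_apply]
  rcases x with ⟨j, h⟩ | ⟨j, h⟩ | l
  · rcases eq_or_ne j m with rfl | hj
    · simp [r_num_last, r_epsilon, r_gamma, r_gamma', swap_apply_def]
    · simp [r_num j (by omega), r_num', swap_apply_def, hj]
  · rcases j with _ | j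
    · simp [r_num'_zero, r_delta' h0, swap_apply_def]
    · simp [r_num' j h, r_num j h, swap_apply_def]
  · cases l <;> simp [r_delta' h0, r_num'_zero, r_delta, r_zeta, r_epsilon, r_gamma, r_gamma',
      r_alpha, r_beta, r_beta', r_alpha', r_num_last, swap_apply_def]

theorem r_pow_four_mul_self (ha : 0 < a) : ((s a)⁻¹ * t a) ^ 4 * ((s a)⁻¹ * t a) ^ 4 = 1 := by
  rw [r_pow_four (2 * a - 1) (by omega) (by omega)]
  ext x
  rcases x with j | j | l
  · by_cases h : j = ⟨2 * a - 1, by omega⟩ <;> simp [swap_apply_def, h]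
  · simp [swap_apply_def]
  · cases l <;> simp [swap_apply_def]

theorem orderOf_r (ha : 0 < a) : orderOf (r a) = 8 := by
  refine orderOf_eq_prime_pow (p := 2) (n := 2) ?_ ?_
  · intro h
    have h1 := congrArg (fun f => f (letter alpha')) h
    rw [show r a = (s a)⁻¹ * t a from rfl, show 2 ^ 2 = 4 from rfl,
      r_pow_four (2 * a - 1) (by omega) (by omega)] at h1
    simp [swap_apply_def] at h1
  · have := r_pow_four_mul_self ha
    rwa [← pow_add] at this

/-- The points moved by the words in question. -/
def wordPoints (m : ℕ) (hm : m + 1 < 2 * a) : List (Point a LetterMinus) :=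
  [num ⟨m, by omega⟩, num' ⟨m, by omega⟩, num ⟨m + 1, hm⟩, num' ⟨m + 1, hm⟩, letter alpha,
    letter alpha', letter beta, letter beta', letter gamma, letter gamma', letter epsilon]

/-- The points moved by the words in question, as an embedding. -/
def wordEmbedding (m : ℕ) (hm : m + 1 < 2 * a) : Fin 11 ↪ Point a LetterMinus :=
  ⟨(wordPoints m hm).get, List.nodup_iff_injective_get.mp (by simp [wordPoints])⟩

theorem r_pow_four_conj (m : ℕ) (hm : m + 1 < 2 * a) (hm' : m + 2 = 2 * a) :
    s a * t a * (s a)⁻¹ * t a * (s a)⁻¹ * ((s a)⁻¹ * t a) ^ 4 *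
      (s a * t a * (s a)⁻¹ * t a * (s a)⁻¹)⁻¹ =
      swap (letter alpha) (num' ⟨m + 1, hm⟩) * swap (letter alpha') (letter beta) *
      swap (num' ⟨m, by omega⟩) (letter epsilon) * swap (letter gamma) (letter beta') := by
  rw [r_pow_four (m + 1) hm hm', Perm.conj_four_swaps]
  have i1 := s_inv_apply (s_num m hm)
  have i2 := s_inv_apply (s_num' m hm)
  have i3 := s_inv_apply (s_num_last (m + 1) hm hm')
  have i4 := s_inv_apply (s_epsilon (m + 1) hm hm')
  have i5 := s_inv_apply (a := a) s_alpha'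
  have i6 := s_inv_apply (a := a) s_beta
  have i7 := s_inv_apply (a := a) s_beta'
  have i8 := s_inv_apply (a := a) s_gamma'
  have i9 := s_inv_apply (a := a) s_alpha
  have i10 := s_inv_apply (a := a) s_gamma
  simp only [Perm.mul_apply, i1, i2, i3, i4, i5, i6, i7, i8, i9, i10, t_num, t_num', t_alpha,
    t_alpha', t_beta, t_beta', t_gamma, t_gamma', t_epsilon, s_num' m hm,
    s_num_last (m + 1) hm hm', s_epsilon (m + 1) hm hm', s_alpha, s_alpha', s_beta, s_beta',
    s_gamma]

/-- In the numbering of `wordPoints` the paths are 2-4-3 and 9-5-6-10-1, and the common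
transposition of 7 and 8 cancels. The fifth power kills the 5-cycle and inverts the 3-cycle. -/
theorem isThreeCycle_chiralWord (ha : 0 < a) : (chiralWord (s a) (t a)).IsThreeCycle := by
  obtain ⟨m, hm⟩ : ∃ m, m + 2 = 2 * a := ⟨2 * a - 2, by omega⟩
  have h : chiralWord (s a) (t a) =
      Perm.viaEmbeddingHom (wordEmbedding (a := a) m (by omega))
        ((swap 2 4 * swap 5 9 * swap 6 10 * swap 7 8 *
          (swap 4 3 * swap 5 6 * swap 1 10 * swap 8 7)) ^ 5) := by
    rw [chiralWord, r_pow_four_conj m (by omega) hm, r_pow_four (m + 1) (by omega) hm]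
    simp only [map_pow, map_mul, Perm.viaEmbeddingHom_swap]
    rfl
  rw [h, show (_ : Perm (Fin 11)) ^ 5 = swap 2 4 * swap 2 3 by decide +kernel, map_mul,
    Perm.viaEmbeddingHom_swap, Perm.viaEmbeddingHom_swap]
  apply Perm.isThreeCycle_swap_mul_swap_same <;> simp

/-- Now the paths are 3-5-10-7 and 0-4-8-9-6-2, so the product of the involutions has order 12,
which does not divide 15. -/
theorem chiralWord_inv_pow_three_ne_one (ha : 0 < a) : chiralWord (s a)⁻¹ (t a) ^ 3 ≠ 1 := by
  obtain ⟨m, hm⟩ : ∃ m, m + 2 = 2 * a := ⟨2 * a - 2, by omega⟩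
  have hm' : m + 1 < 2 * a := by omega
  have h1 := inv_inv_mul_pow_four t_mul_t (r_pow_four_mul_self ha)
  rw [r_pow_four (m + 1) hm' hm, Perm.conj_four_swaps] at h1
  simp only [t_num, t_alpha, t_alpha', t_gamma', t_beta, t_epsilon, t_beta', t_gamma] at h1
  have h : chiralWord (s a)⁻¹ (t a) =
      Perm.viaEmbeddingHom (wordEmbedding (a := a) m (by omega))
        ((swap 3 5 * swap 4 8 * swap 7 10 * swap 6 9 *
          (swap 10 5 * swap 4 0 * swap 2 6 * swap 9 8)) ^ 5) := by
    rw [chiralWord, h1, Perm.conj_four_swaps]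
    have i1 := s_inv_apply (s_num m hm')
    have i4 := s_inv_apply (s_epsilon (m + 1) hm' hm)
    have i5 := s_inv_apply (a := a) s_alpha'
    have i6 := s_inv_apply (a := a) s_beta
    have i8 := s_inv_apply (a := a) s_gamma'
    have i9 := s_inv_apply (a := a) s_alpha
    have i10 := s_inv_apply (a := a) s_gamma
    have i3 := s_inv_apply (s_num_last (m + 1) hm' hm)
    simp only [inv_inv, Perm.mul_apply, i1, i3, i4, i5, i6, i8, i9, i10, t_num, t_num', t_alpha,
      t_alpha', t_beta, t_beta', t_gamma, t_gamma', t_epsilon, s_num' m hm', s_num m hm',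
      s_num_last (m + 1) hm' hm, s_epsilon (m + 1) hm' hm, s_alpha, s_alpha', s_beta, s_beta',
      s_gamma, s_gamma', map_pow, map_mul, Perm.viaEmbeddingHom_swap]
    rfl
  rw [h, ← map_pow, ← map_one (Perm.viaEmbeddingHom (wordEmbedding (a := a) m hm'))]
  refine (Perm.viaEmbeddingHom_injective _).ne ?_
  decide +kernel

theorem sign_r : Perm.sign (r a) = 1 := by simp [r, sign_s, sign_t]

theorem map_isChiral (ha : 0 < a) : (map a).IsChiral := by
  refine mapOfPerms_isChiral _ ?_ ?_ <;> rw [s_mul_r]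
  · rw [← (isThreeCycle_chiralWord ha).orderOf, pow_orderOf_eq_one]
  · exact chiralWord_inv_pow_three_ne_one ha

theorem map_hasType (ha : 0 < a) : (map a).HasType 8 (4 * a + 6) := by
  have := mapOfPerms_hasType (r := r a) (s := s a) (by rw [s_mul_r, orderOf_t])
  rwa [orderOf_r ha, orderOf_s] at this

theorem genGroup_eq (ha : 0 < a) :
    genGroup (r a) (s a) = alternatingGroup (Point a LetterMinus) :=
  genGroup_eq_alternatingGroup (isPreprimitive ha)
    (by rw [s_mul_r]; exact isThreeCycle_chiralWord ha) sign_r sign_s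

end Minus

/-! ### Case `i = 1`: action of `s` and `t` on the points -/

namespace Plus

open Point LetterPlus

variable {a : ℕ}

/-- The points of the long cycle of `s`, in cyclic order. -/
def cycleList (a : ℕ) : List (Point a LetterPlus) :=
  ascending a _ ++ [letter alpha, letter beta, letter gamma, letter gamma', letter epsilon] ++
    descending' a _ ++ [letter delta, letter zeta, letter delta']

theorem length_cycleList : (cycleList a).length = 4 * a + 8 := by
  simp [cycleList, length_ascending, length_descending']; omega

theorem nodup_cycleList : (cycleList a).Nodup := by
  simp only [cycleList, List.nodup_append, nodup_ascending, nodup_descending',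
    List.mem_append, mem_ascending, mem_descending']
  simp
  grind

theorem s_eq : s a = (cycleList a).formPerm * swap (letter alpha') (letter eta) := rfl

theorem notMem_alpha' : (letter alpha' : Point a LetterPlus) ∉ cycleList a := by
  simp [cycleList, mem_ascending, mem_descending']

theorem notMem_eta : (letter eta : Point a LetterPlus) ∉ cycleList a := by
  simp [cycleList, mem_ascending, mem_descending']

theorem s_apply_of_getElem? {x y : Point a LetterPlus} (i : ℕ) (hx : (cycleList a)[i]? = some x)
    (hy : (cycleList a)[i + 1]? = some y) : s a x = y := by
  have hm := List.mem_of_getElem? hx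
  rw [s_eq, Perm.mul_apply, swap_apply_of_ne_of_ne]
  · exact List.formPerm_apply_of_getElem? nodup_cycleList i hx hy
  · rintro rfl; exact notMem_alpha' hm
  · rintro rfl; exact notMem_eta hm

theorem getElem?_num (j : Fin (2 * a)) : (cycleList a)[(j : ℕ)]? = some (num j) := by
  rw [cycleList, List.append_assoc, List.append_assoc,
    List.getElem?_append_left (by rw [length_ascending]; exact j.2), getElem?_ascending]

theorem getElem?_letter (k : ℕ) (hk : k < 5) : (cycleList a)[2 * a + k]? =
    [letter alpha, letter beta, letter gamma, letter gamma', letter epsilon][k]? := by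
  rw [cycleList, List.append_assoc, List.append_assoc,
    List.getElem?_append_right (by rw [length_ascending]; omega),
    List.getElem?_append_left (by simp [length_ascending, hk]), length_ascending]
  simp

theorem getElem?_num' (k : ℕ) (j : Fin (2 * a)) (hk : k + j + 1 = 2 * a) :
    (cycleList a)[2 * a + 5 + k]? = some (num' j) := by
  rw [cycleList, List.getElem?_append_left, List.getElem?_append_right]
  · rw [← getElem?_descending' j hk]
    simp [length_ascending]
  · simp [length_ascending]
  · simp [length_ascending, length_descending']; omega

theorem getElem?_letter' (k : ℕ) : (cycleList a)[4 * a + 5 + k]? =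
    [letter delta, letter zeta, letter delta'][k]? := by
  rw [cycleList, List.getElem?_append_right]
  · simp [length_ascending, length_descending']; congr 1; omega
  · simp [length_ascending, length_descending']; omega

/-- The point before `α` in the long cycle of `s`. -/
def lastPoint : (a : ℕ) → Point a LetterPlus
  | 0 => letter delta'
  | a + 1 => num ⟨2 * a + 1, by omega⟩

/-- The point after `ε` in the long cycle of `s`. -/
def lastPoint' : (a : ℕ) → Point a LetterPlus
  | 0 => letter delta
  | a + 1 => num' ⟨2 * a + 1, by omega⟩

/-- The second point before `α` in the long cycle of `s`. -/
def prevPoint : (a : ℕ) → Point a LetterPlus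
  | 0 => letter zeta
  | a + 1 => num ⟨2 * a, by omega⟩

/-- The second point after `ε` in the long cycle of `s`. -/
def prevPoint' : (a : ℕ) → Point a LetterPlus
  | 0 => letter zeta
  | a + 1 => num' ⟨2 * a, by omega⟩

theorem s_num (j : ℕ) (h : j + 1 < 2 * a) :
    s a (num ⟨j, Nat.lt_of_succ_lt h⟩) = num ⟨j + 1, h⟩ :=
  s_apply_of_getElem? j (getElem?_num ⟨j, Nat.lt_of_succ_lt h⟩) (getElem?_num ⟨j + 1, h⟩)

theorem s_num' (j : ℕ) (h : j + 1 < 2 * a) :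
    s a (num' ⟨j + 1, h⟩) = num' ⟨j, Nat.lt_of_succ_lt h⟩ :=
  s_apply_of_getElem? _ (getElem?_num' (2 * a - j - 2) ⟨j + 1, h⟩ (by simp only; omega))
    (getElem?_num' (2 * a - j - 2 + 1) ⟨j, Nat.lt_of_succ_lt h⟩ (by simp only; omega))

theorem s_num'_zero (h : 0 < 2 * a) : s a (num' ⟨0, h⟩) = letter delta := by
  refine s_apply_of_getElem? _ (getElem?_num' (2 * a - 1) ⟨0, h⟩ (by simp only; omega)) ?_
  rw [show 2 * a + 5 + (2 * a - 1) + 1 = 4 * a + 5 + 0 by omega, getElem?_letter']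
  rfl

theorem s_delta : s a (letter delta) = letter zeta :=
  s_apply_of_getElem? _ (getElem?_letter' 0) (getElem?_letter' 1)

theorem s_zeta : s a (letter zeta) = letter delta' :=
  s_apply_of_getElem? _ (getElem?_letter' 1) (getElem?_letter' 2)

theorem s_delta'_of_getElem? {x : Point a LetterPlus} (h : (cycleList a)[0]? = some x) :
    s a (letter delta') = x := by
  rw [s_eq, Perm.mul_apply, swap_apply_of_ne_of_ne (by simp) (by simp)]
  exact List.formPerm_apply_of_getElem?_last nodup_cycleList (4 * a + 5 + 2)
    (by rw [length_cycleList]) (getElem?_letter' 2) h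

theorem s_delta' (h : 0 < 2 * a) : s a (letter delta') = num ⟨0, h⟩ :=
  s_delta'_of_getElem? (getElem?_num ⟨0, h⟩)

theorem s_lastPoint : s a (lastPoint a) = letter alpha := by
  rcases a with _ | a
  · exact s_delta'_of_getElem? (getElem?_letter 0 (by omega))
  · exact s_apply_of_getElem? _ (getElem?_num ⟨2 * a + 1, by omega⟩) (getElem?_letter 0 (by omega))

theorem s_prevPoint : s a (prevPoint a) = lastPoint a := by
  rcases a with _ | a
  · exact s_zeta
  · exact s_num (2 * a) (by omega)

theorem s_epsilon : s a (letter epsilon) = lastPoint' a := by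
  refine s_apply_of_getElem? _ (getElem?_letter 4 (by omega)) ?_
  rcases a with _ | a
  · exact getElem?_letter' 0
  · exact getElem?_num' 0 ⟨2 * a + 1, by omega⟩ (by simp only; omega)

theorem s_lastPoint' : s a (lastPoint' a) = prevPoint' a := by
  rcases a with _ | a
  · exact s_delta
  · exact s_num' (2 * a) (by omega)

theorem s_alpha : s a (letter alpha) = letter beta :=
  s_apply_of_getElem? _ (getElem?_letter 0 (by omega)) (getElem?_letter 1 (by omega))

theorem s_beta : s a (letter beta) = letter gamma :=
  s_apply_of_getElem? _ (getElem?_letter 1 (by omega)) (getElem?_letter 2 (by omega))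

theorem s_gamma : s a (letter gamma) = letter gamma' :=
  s_apply_of_getElem? _ (getElem?_letter 2 (by omega)) (getElem?_letter 3 (by omega))

theorem s_gamma' : s a (letter gamma') = letter epsilon :=
  s_apply_of_getElem? _ (getElem?_letter 3 (by omega)) (getElem?_letter 4 (by omega))

theorem s_of_notMem {x : Point a LetterPlus} (h : x ∉ cycleList a) :
    s a x = swap (letter alpha') (letter eta) x := by
  rw [s_eq, Perm.mul_apply, List.formPerm_apply_of_notMem]
  rw [swap_apply_def]
  split_ifs
  exacts [notMem_eta, notMem_alpha', h]

theorem s_alpha' : s a (letter alpha') = letter eta := by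
  simp [s_of_notMem notMem_alpha']

theorem s_eta : s a (letter eta) = letter alpha' := by
  simp [s_of_notMem notMem_eta]

theorem s_beta' : s a (letter beta') = letter beta' := by
  rw [s_of_notMem (by simp [cycleList, mem_ascending, mem_descending'])]
  simp [swap_apply_def]

theorem disjoint : Perm.Disjoint (cycleList a).formPerm (swap (letter alpha') (letter eta)) := by
  intro x
  by_cases hx : x ∈ cycleList a
  · right
    apply swap_apply_of_ne_of_ne
    · rintro rfl; exact notMem_alpha' hx
    · rintro rfl; exact notMem_eta hx
  · exact Or.inl (List.formPerm_apply_of_notMem hx)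

theorem orderOf_s : orderOf (s a) = 4 * a + 8 := by
  rw [s_eq, disjoint.orderOf, List.orderOf_formPerm_of_nodup nodup_cycleList, length_cycleList,
    Perm.IsSwap.orderOf ⟨_, _, by simp, rfl⟩]
  · exact Nat.lcm_eq_left ⟨2 * a + 4, by omega⟩
  · rw [length_cycleList]; omega

theorem sign_s : Perm.sign (s a) = 1 := by
  rw [s_eq, map_mul, List.sign_formPerm_of_nodup nodup_cycleList, length_cycleList,
    Perm.sign_swap (by simp)]
  · rw [Even.neg_one_pow ⟨2 * a + 4, by omega⟩]; rfl
  · rw [length_cycleList]; omega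

theorem t_num (j : Fin (2 * a)) : t a (num j) = num' j := by
  simp [t, tNum_num, swap_apply_def]

theorem t_num' (j : Fin (2 * a)) : t a (num' j) = num j := by
  simp [t, tNum_num', swap_apply_def]

theorem t_alpha : t a (letter alpha) = letter alpha' := by simp [t, tNum_letter, swap_apply_def]
theorem t_alpha' : t a (letter alpha') = letter alpha := by simp [t, tNum_letter, swap_apply_def]
theorem t_beta : t a (letter beta) = letter beta' := by simp [t, tNum_letter, swap_apply_def]
theorem t_beta' : t a (letter beta') = letter beta := by simp [t, tNum_letter, swap_apply_def]
theorem t_gamma : t a (letter gamma) = letter gamma' := by simp [t, tNum_letter, swap_apply_def]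
theorem t_gamma' : t a (letter gamma') = letter gamma := by simp [t, tNum_letter, swap_apply_def]
theorem t_delta : t a (letter delta) = letter delta' := by simp [t, tNum_letter, swap_apply_def]
theorem t_delta' : t a (letter delta') = letter delta := by simp [t, tNum_letter, swap_apply_def]
theorem t_epsilon : t a (letter epsilon) = letter epsilon := by
  simp [t, tNum_letter, swap_apply_def]
theorem t_eta : t a (letter eta) = letter eta := by
  simp [t, tNum_letter, swap_apply_def]
theorem t_zeta : t a (letter zeta) = letter zeta := by simp [t, tNum_letter, swap_apply_def]

theorem t_lastPoint : t a (lastPoint a) = lastPoint' a := by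
  rcases a with _ | a
  exacts [t_delta', t_num _]

theorem t_lastPoint' : t a (lastPoint' a) = lastPoint a := by
  rcases a with _ | a
  exacts [t_delta, t_num' _]

theorem t_prevPoint : t a (prevPoint a) = prevPoint' a := by
  rcases a with _ | a
  exacts [t_zeta, t_num _]

theorem t_prevPoint' : t a (prevPoint' a) = prevPoint a := by
  rcases a with _ | a
  exacts [t_zeta, t_num' _]

theorem sign_t : Perm.sign (t a) = 1 := by
  simp [t, sign_tNum]

end Plus

/-! ### Case `i = 1`: primitivity, order of `r`, and the 3-cycle -/

namespace Plus

open Point LetterPlus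

variable {a : ℕ}

theorem s_mul_r : s a * r a = t a := mul_inv_cancel_left _ _

theorem t_mul_t : t a * t a = 1 := by
  rw [← sq, ← orderOf_t a, pow_orderOf_eq_one]

theorem r_apply {x y : Point a LetterPlus} (h : t a x = s a y) : r a x = y := by
  rw [r, Perm.mul_apply, h]; exact (s a).symm_apply_apply y

theorem s_inv_apply {x y : Point a LetterPlus} (h : s a y = x) : (s a)⁻¹ x = y := by
  rw [← h]; exact (s a).symm_apply_apply y

theorem mem_iff_of_mem_cycleList {S : Set (Point a LetterPlus)} (hs : ∀ z, z ∈ S ↔ s a z ∈ S)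
    {x y : Point a LetterPlus} (hx : x ∈ cycleList a) (hy : y ∈ cycleList a) : x ∈ S ↔ y ∈ S :=
  List.mem_iff_of_forall_getElem? (fun i _ _ => s_apply_of_getElem? i) hs hx hy

theorem eq_univ_of_beta_mem {S : Set (Point a LetterPlus)} (hs : ∀ z, z ∈ S ↔ s a z ∈ S)
    (ht : ∀ z, z ∈ S ↔ t a z ∈ S) (h : letter beta ∈ S) : S = Set.univ := by
  have hc {x : Point a LetterPlus} (hx : x ∈ cycleList a) : x ∈ S :=
    (mem_iff_of_mem_cycleList hs hx (by simp [cycleList])).mpr h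
  have ha : letter alpha' ∈ S := by
    rw [← t_alpha, ← ht]; exact hc (by simp [cycleList])
  ext x
  simp only [Set.mem_univ, iff_true]
  by_cases hx : x ∈ cycleList a
  · exact hc hx
  rcases x with j | j | l
  · simp [cycleList, mem_ascending] at hx
  · simp [cycleList, mem_descending'] at hx
  · cases l
    case alpha' => exact ha
    case eta => rwa [← s_alpha', ← hs]
    case beta' => rwa [← t_beta, ← ht]
    all_goals simp [cycleList] at hx

theorem isPreprimitive :
    MulAction.IsPreprimitive (genGroup (r a) (s a)) (Point a LetterPlus) := by
  have hsG : s a ∈ genGroup (r a) (s a) := Subgroup.subset_closure (Or.inr rfl)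
  have htG : t a ∈ genGroup (r a) (s a) := by
    rw [← s_mul_r]
    exact mul_mem hsG (Subgroup.subset_closure (Or.inl rfl))
  refine Subgroup.isPreprimitive_of_forall_block (letter beta') (fun S hS h => ?_)
    fun B hB h z hz hne => ?_
  · refine eq_univ_of_beta_mem (h _ hsG) (h _ htG) ?_
    rwa [h _ htG, t_beta]
  -- Here `β'` is the only fixed point of `s`, so again the block is invariant under `s`.
  have hs := h _ hsG _ hB (by rwa [s_beta'])
  have hb (hg : letter beta ∈ B) : B = Set.univ :=
    eq_univ_of_beta_mem hs (h _ htG _ hB (by rwa [t_beta'])) hg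
  have heta (he : letter eta ∈ B) : B = Set.univ := by
    -- `t` fixes `η`, so a block containing it is invariant under `t` as well.
    have ht := h _ htG _ he (by rwa [t_eta])
    exact hb (by rwa [ht, t_beta])
  by_cases hx : z ∈ cycleList a
  · exact hb ((mem_iff_of_mem_cycleList hs hx (by simp [cycleList])).mp hz)
  rcases z with j | j | l
  · simp [cycleList, mem_ascending] at hx
  · simp [cycleList, mem_descending'] at hx
  · cases l
    case alpha' => exact heta (by rwa [← s_alpha', ← hs])
    case eta => exact heta hz
    case beta' => exact absurd rfl hne
    all_goals simp [cycleList] at hx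

/-- The 8-cycle of `r` is `(lastPoint, ε, γ', β, β', α, η, α')`; `r` fixes `γ`, and the remaining
points form 2-cycles. -/
theorem r_pow_four : ((s a)⁻¹ * t a) ^ 4 = swap (lastPoint a) (letter beta') *
      swap (letter alpha) (letter epsilon) * swap (letter alpha') (letter beta) *
      swap (letter gamma') (letter eta) := by
  change r a ^ 4 = _
  have r_num (j : ℕ) (h : j + 1 < 2 * a) :
      r a (num ⟨j, Nat.lt_of_succ_lt h⟩) = num' ⟨j + 1, h⟩ := r_apply (by rw [t_num, s_num' j h])
  have r_num' (j : ℕ) (h : j + 1 < 2 * a) :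
      r a (num' ⟨j + 1, h⟩) = num ⟨j, Nat.lt_of_succ_lt h⟩ := r_apply (by rw [t_num', s_num j h])
  have r_num'_zero (h : 0 < 2 * a) : r a (num' ⟨0, h⟩) = letter delta' :=
    r_apply (by rw [t_num', s_delta'])
  have r_delta' (h : 0 < 2 * a) : r a (letter delta') = num' ⟨0, h⟩ :=
    r_apply (by rw [t_delta', s_num'_zero])
  have r_delta : r a (letter delta) = letter zeta := r_apply (by rw [t_delta, s_zeta])
  have r_zeta : r a (letter zeta) = letter delta := r_apply (by rw [t_zeta, s_delta])
  have r_lastPoint : r a (lastPoint a) = letter epsilon :=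
    r_apply (by rw [t_lastPoint, s_epsilon])
  have r_epsilon : r a (letter epsilon) = letter gamma' := r_apply (by rw [t_epsilon, s_gamma'])
  have r_gamma : r a (letter gamma) = letter gamma := r_apply (by rw [t_gamma, s_gamma])
  have r_gamma' : r a (letter gamma') = letter beta := r_apply (by rw [t_gamma', s_beta])
  have r_beta : r a (letter beta) = letter beta' := r_apply (by rw [t_beta, s_beta'])
  have r_beta' : r a (letter beta') = letter alpha := r_apply (by rw [t_beta', s_alpha])
  have r_alpha : r a (letter alpha) = letter eta := r_apply (by rw [t_alpha, s_eta])
  have r_eta : r a (letter eta) = letter alpha' := r_apply (by rw [t_eta, s_alpha'])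
  have r_alpha' : r a (letter alpha') = lastPoint a :=
    r_apply (by rw [t_alpha', s_lastPoint])
  ext x
  simp only [pow_succ, pow_zero, one_mul, Perm.mul_apply]
  -- For `a = 0` the point `δ'` is `lastPoint` and lies on the 8-cycle; otherwise it forms a 2-cycle
  -- with `1'`.
  rcases a with _ | a
  · rw [lastPoint] at r_lastPoint r_alpha' ⊢
    rcases x with j | j | l
    · exact j.elim0
    · exact j.elim0
    · cases l <;> simp [r_delta, r_zeta, r_epsilon, r_gamma, r_gamma',
        r_alpha, r_beta, r_beta', r_alpha', r_eta, r_lastPoint, swap_apply_def]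
  rw [lastPoint] at r_lastPoint r_alpha' ⊢
  rcases x with ⟨j, h⟩ | ⟨j, h⟩ | l
  · rcases eq_or_ne j (2 * a + 1) with rfl | hj
    · simp [r_lastPoint, r_epsilon, r_beta, r_gamma', swap_apply_def]
    · simp [r_num j (by omega), r_num', swap_apply_def, hj]
  · rcases j with _ | j
    · rw [r_num'_zero, r_delta' h, r_num'_zero, r_delta' h]
      simp [swap_apply_def]
    · simp [r_num' j h, r_num j h, swap_apply_def]
  · cases l
    case delta' =>
      rw [r_delta' (by omega), r_num'_zero, r_delta' (by omega), r_num'_zero]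
      simp [swap_apply_def]
    all_goals simp [r_delta, r_zeta, r_epsilon, r_gamma, r_gamma', r_alpha, r_beta, r_beta',
      r_alpha', r_eta, r_lastPoint, swap_apply_def]

/-- The points moved by the words in question. -/
def wordPoints (a : ℕ) : List (Point a LetterPlus) :=
  [lastPoint a, lastPoint' a, prevPoint' a, letter alpha, letter alpha', letter beta,
    letter beta', letter gamma, letter gamma', letter epsilon, letter eta]

/-- The points moved by the words in question, as an embedding. -/
def wordEmbedding (a : ℕ) : Fin 11 ↪ Point a LetterPlus :=
  ⟨(wordPoints a).get, List.nodup_iff_injective_get.mp (by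
    -- Distinctness survives at `a = 0` because `prevPoint`, which then equals `prevPoint'`, is not
    -- listed.
    rcases a with _ | a <;> simp [wordPoints, lastPoint, lastPoint', prevPoint'])⟩

theorem r_pow_four_eq_viaEmbeddingHom : ((s a)⁻¹ * t a) ^ 4 = Perm.viaEmbeddingHom
    (wordEmbedding a) (swap 0 6 * swap 3 9 * swap 4 5 * swap 8 10) := by
  simp only [r_pow_four, map_mul, Perm.viaEmbeddingHom_swap]
  rfl

theorem r_pow_four_mul_self : ((s a)⁻¹ * t a) ^ 4 * ((s a)⁻¹ * t a) ^ 4 = 1 := by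
  rw [r_pow_four_eq_viaEmbeddingHom, ← map_mul, ← map_one (Perm.viaEmbeddingHom _)]
  congr 1
  decide +kernel

theorem orderOf_r : orderOf (r a) = 8 := by
  refine orderOf_eq_prime_pow (p := 2) (n := 2) ?_ ?_
  · change ((s a)⁻¹ * t a) ^ 4 ≠ 1
    rw [r_pow_four_eq_viaEmbeddingHom, ← map_one (Perm.viaEmbeddingHom (wordEmbedding a))]
    exact (Perm.viaEmbeddingHom_injective _).ne (by decide +kernel)
  · have := r_pow_four_mul_self (a := a)
    rwa [← pow_add] at this

/-- The paths are 0-6-1 and 2-9-3-10-8, and the transposition of 4 and 5 cancels. -/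
theorem isThreeCycle_chiralWord : (chiralWord (s a) (t a)).IsThreeCycle := by
  have h : chiralWord (s a) (t a) = Perm.viaEmbeddingHom (wordEmbedding a)
      ((swap 0 6 * swap 3 9 * swap 4 5 * swap 8 10 *
        (swap 3 10 * swap 1 6 * swap 5 4 * swap 9 2)) ^ 5) := by
    rw [chiralWord, r_pow_four, Perm.conj_four_swaps]
    simp only [Perm.mul_apply, s_inv_apply s_lastPoint, s_inv_apply s_prevPoint,
      s_inv_apply s_epsilon, s_inv_apply s_lastPoint', s_inv_apply s_alpha, s_inv_apply s_beta,
      s_inv_apply s_gamma, s_inv_apply s_gamma', s_inv_apply s_alpha', s_inv_apply s_beta',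
      s_inv_apply s_eta, t_lastPoint, t_lastPoint', t_prevPoint, t_alpha, t_alpha',
      t_beta, t_beta', t_gamma, t_gamma', t_epsilon, t_eta, s_lastPoint, s_epsilon,
      s_lastPoint', s_alpha, s_gamma', s_alpha', s_beta', s_eta,
      map_pow, map_mul, Perm.viaEmbeddingHom_swap]
    rfl
  rw [h, show (_ : Perm (Fin 11)) ^ 5 = swap 0 6 * swap 0 1 by decide +kernel, map_mul,
    Perm.viaEmbeddingHom_swap, Perm.viaEmbeddingHom_swap]
  apply Perm.isThreeCycle_swap_mul_swap_same <;> simp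

/-- The paths are 4-9-8 and 1-5-6-3-7-10-0; the 7-cycle survives the fifteenth power. -/
theorem chiralWord_inv_pow_three_ne_one : chiralWord (s a)⁻¹ (t a) ^ 3 ≠ 1 := by
  have h : chiralWord (s a)⁻¹ (t a) = Perm.viaEmbeddingHom (wordEmbedding a)
      ((swap 1 5 * swap 4 9 * swap 3 6 * swap 7 10 *
        (swap 9 8 * swap 0 10 * swap 3 7 * swap 5 6)) ^ 5) := by
    rw [chiralWord, inv_inv_mul_pow_four t_mul_t r_pow_four_mul_self, r_pow_four,
      Perm.conj_four_swaps]
    simp only [t_lastPoint, t_alpha, t_alpha', t_beta, t_beta', t_gamma', t_epsilon, t_eta]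
    rw [Perm.conj_four_swaps]
    simp only [inv_inv, Perm.mul_apply, s_inv_apply s_lastPoint,
      s_inv_apply s_epsilon, s_inv_apply s_alpha, s_inv_apply s_beta,
      s_inv_apply s_gamma, s_inv_apply s_gamma', s_inv_apply s_beta',
      s_inv_apply s_eta, t_lastPoint, t_lastPoint', t_prevPoint', t_alpha, t_alpha',
      t_beta, t_beta', t_gamma, t_gamma', t_epsilon, t_eta, s_lastPoint, s_prevPoint, s_epsilon,
      s_lastPoint', s_alpha, s_beta, s_gamma, s_gamma', s_alpha', s_beta', s_eta,
      map_pow, map_mul, Perm.viaEmbeddingHom_swap]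
    rfl
  rw [h, ← map_pow, ← map_one (Perm.viaEmbeddingHom (wordEmbedding a))]
  exact (Perm.viaEmbeddingHom_injective _).ne (by decide +kernel)

theorem sign_r : Perm.sign (r a) = 1 := by simp [r, sign_s, sign_t]

theorem map_isChiral : (map a).IsChiral := by
  refine mapOfPerms_isChiral _ ?_ ?_ <;> rw [s_mul_r]
  · rw [← (isThreeCycle_chiralWord (a := a)).orderOf, pow_orderOf_eq_one]
  · exact chiralWord_inv_pow_three_ne_one

theorem map_hasType : (map a).HasType 8 (4 * a + 8) := by
  have := mapOfPerms_hasType (r := r a) (s := s a) (by rw [s_mul_r, orderOf_t])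
  rwa [orderOf_r, orderOf_s] at this

theorem genGroup_eq :
    genGroup (r a) (s a) = alternatingGroup (Point a LetterPlus) :=
  genGroup_eq_alternatingGroup isPreprimitive
    (by rw [s_mul_r]; exact isThreeCycle_chiralWord) sign_r sign_s

end Plus

theorem proposition4p3 (a n : ℕ) (hn : 8 ≤ n) :
    ((n : ℤ) = 4 * a + 7 + (-1) →
      (Minus.map a).IsChiral ∧ (Minus.map a).HasType 8 n ∧
        genGroup (Minus.r a) (Minus.s a) = alternatingGroup (Point a LetterMinus)) ∧
    ((n : ℤ) = 4 * a + 7 + 1 →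
      (Plus.map a).IsChiral ∧ (Plus.map a).HasType 8 n ∧
        genGroup (Plus.r a) (Plus.s a) = alternatingGroup (Point a LetterPlus)) := by
  refine ⟨fun h => ?_, fun h => ?_⟩
  -- Here `8 ≤ n` is essential: `a = 0` would give `n = 6`.
  · have ha : 0 < a := by omega
    obtain rfl : n = 4 * a + 6 := by omega
    exact ⟨Minus.map_isChiral ha, Minus.map_hasType ha, Minus.genGroup_eq ha⟩
  · obtain rfl : n = 4 * a + 8 := by omega
    exact ⟨Plus.map_isChiral, Plus.map_hasType, Plus.genGroup_eq⟩
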